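/- **Setting.** Let $m,n\ge 1$ and let $A\in[-1,1]^{m\times n}$ be a boosting matrix. For $\ell:\mathbb R\to\mathbb R$ and $z\in\mathbb R$ let $C_\ell(z)\in[1,\infty]$ be the smallest constant with $C_\ell(z)^{-1}\le e^{x}/\ell^{(i)}(x)\le C_\ell(z)$ for all $x\le z$ and $i\in\{0,1,2\}$. Let $\mathbb L$ be the class of all $\ell:\mathbb R\to[0,\infty)$ that are twice continuously differentiable and strictly convex with $C_\ell(z)<\infty$ for every $z\in\mathbb R$. For $\ell\in\mathbb L$ put $\mathcal L(z)=\frac1m\sum_{i=1}^m\ell(z_i)$ for $z\in\mathbb R^m$ and $\bar{\mathcal L}_A=\inf_{\lambda\in\mathbb R^n}\mathcal L(A\lambda)$. *Algorithm.* Start from $\lambda_0=0$. For $t=1,2,\dots$ choose a column $j_t\in\arg\max_j|\nabla\mathcal L(A\lambda_{t-1})^\top A e_j|$ (ties are broken arbitrarily) and a direction $v_t\in\{\pm e_{j_t}\}$ with $\nabla\mathcal L(A\lambda_{t-1})^\top Av_t=-\|A^\top\nabla\mathcal L(A\lambda_{t-1})\|_\infty$, and set $\lambda_t=\lambda_{t-1}+\alpha_tv_t$.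 Put $\gamma_t=\|A^\top\nabla\mathcal L(A\lambda_{t-1})\|_\infty/\|\nabla\mathcal L(A\lambda_{t-1})\|_1$ and $C_t=C_\ell(\ell^{-1}(m\mathcal L(A\lambda_{t-1})))$, and let $\nu\in(0,1]$ be a shrinkage parameter. The step sizes follow one of these rules, the same one for all $t$: * quadratic upper bound: $\alpha_t=\nu\gamma_t/C_t^4$; * Wolfe: $\alpha_t$ is any number $\alpha$ with $\mathcal L(A(\lambda_{t-1}+\alpha v_t))\le\mathcal L(A\lambda_{t-1})-\alpha(1-\nu/2)\|A^\top\nabla\mathcal L(A\lambda_{t-1})\|_\infty$ and $\nabla\mathcal L(A(\lambda_{t-1}+\alpha v_t))^\top Av_t\ge-(1-\nu/4)\|A^\top\nabla\mathcal L(A\lambda_{t-1})\|_\infty$; * optimal: $\alpha_t=\nu\alpha$, where $\alpha$ is a minimizer (assumed to exist) of $\alpha\mapsto\mathcal L(A(\lambda_{t-1}+\alpha v_t))$ over $\mathbb R$; * AdaBoost, only for $\ell=\exp$ and $A\in\{-1,+1\}^{m\times n}$: $\alpha_t=\frac\nu2\ln\frac{1+\gamma_t}{1-\gamma_t}$, where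 $\gamma_t<1$ is assumed. *Structure of the instance.* Let $\gamma=\max_{\|\lambda\|_1=1}\min_{i\in[m]}-e_i^\top A\lambda$; the instance is separable if $\gamma>0$. A set $H\subseteq[m]$ is a hard core for $A$ if (i) some $\hat\lambda\in\mathbb R^n$ has $e_i^\top A\hat\lambda<0$ for $i\notin H$ and $e_i^\top A\hat\lambda=0$ for $i\in H$, and (ii) every $\lambda\in\mathbb R^n$ with $e_i^\top A\lambda<0$ for some $i\in H$ has $e_k^\top A\lambda>0$ for some $k\in H$. **Theorem.** Let $A\in[-1,1]^{m\times n}$ (possibly not separable), $\nu\in(0,1]$ and $\ell\in\mathbb L$. 1. There is a constant $K>0$, depending only on $A$, $\ell$ and $\nu$, such that for every sequence $(\lambda_t)_{t\ge0}$ of iterates produced with any of the above step size rules (AdaBoost only with $\ell=\exp$ and binary $A$) and every $\epsilon>0$, $$\mathcal L(A\lambda_t)-\bar{\mathcal L}_A\le\epsilon\qquad\text{for all integers } t\ge K\cdot\tfrac1\epsilon .$$ That is, $O(1/\epsilon)$ iterations suffice to reach suboptimality $\epsilon$. 2. If the instance is separable ($\gamma>0$), or $\lambda\mapsto\mathcal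 L(A\lambda)$ attains its infimum, or $A$ has a hard core with $m$ elements, then there is a constant $K>0$, depending only on $A$, $\ell$ and $\nu$, such that for all such sequences and every $\epsilon>0$, $$\mathcal L(A\lambda_t)-\bar{\mathcal L}_A\le\epsilon\qquad\text{for all integers } t\ge K\max\{1,\ln\tfrac1\epsilon\}.$$ That is, $O(\ln(1/\epsilon))$ iterations suffice. -/

import Mathlib

open scoped Matrix NNReal ENNReal

noncomputable section

namespace Boosting

/-- `c` is a valid constant for the loss `ℓ` on `(-∞, z]`: the ratios of `exp` to `ℓ`, `ℓ'`, `ℓ''`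
lie in `[1 / c, c]` there. (If a derivative vanishes at some `x ≤ z`, the ratio is `0` in Lean, so
that no `c` is valid.) -/
def IsLossBound (ℓ : ℝ → ℝ) (z : ℝ) (c : ℝ≥0) : Prop :=
  1 ≤ c ∧ ∀ x ≤ z, ∀ i ∈ ({0, 1, 2} : Finset ℕ),
    (c : ℝ)⁻¹ ≤ Real.exp x / iteratedDeriv i ℓ x ∧ Real.exp x / iteratedDeriv i ℓ x ≤ c

/-- The tightest constant `C_ℓ(z) ∈ [1, ∞]`; it is `∞` if there is no valid constant. -/
def lossConst (ℓ : ℝ → ℝ) (z : ℝ) : ℝ≥0∞ :=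
  ⨅ (c : ℝ≥0) (_ : IsLossBound ℓ z c), (c : ℝ≥0∞)

/-- The class `𝕃` of losses. -/
structure LossClass (ℓ : ℝ → ℝ) : Prop where
  nonneg : ∀ x, 0 ≤ ℓ x
  contDiff : ContDiff ℝ 2 ℓ
  strictConvex : StrictConvexOn ℝ Set.univ ℓ
  lossConst_lt_top : ∀ z, lossConst ℓ z < ⊤

variable {m n : ℕ}

/-- The empirical risk `𝓛(z) = (1/m) ∑ i, ℓ (z i)`. -/
def risk (ℓ : ℝ → ℝ) (z : Fin m → ℝ) : ℝ :=
  (m : ℝ)⁻¹ * ∑ i, ℓ (z i)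

/-- The gradient `∇𝓛(z)`, as the vector of partial derivatives. -/
def riskGrad (ℓ : ℝ → ℝ) (z : Fin m → ℝ) : Fin m → ℝ :=
  fun i => fderiv ℝ (risk ℓ) z (Pi.single i 1)

/-- The optimal value `inf_x 𝓛(A x)`. -/
def optRisk (A : Matrix (Fin m) (Fin n) ℝ) (ℓ : ℝ → ℝ) : ℝ :=
  ⨅ x : Fin n → ℝ, risk ℓ (A *ᵥ x)

/-- The `ℓ¹` norm. -/
def l1norm {k : ℕ} (x : Fin k → ℝ) : ℝ := ∑ i, |x i|

/-- The minimum `ℓ¹` margin of the weighting `x` over the sample. -/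
def margin (A : Matrix (Fin m) (Fin n) ℝ) (x : Fin n → ℝ) : ℝ :=
  ⨅ i : Fin m, -(A *ᵥ x) i / l1norm x

/-- The best margin `γ` over weightings of unit `ℓ¹` norm. -/
def bestMargin (A : Matrix (Fin m) (Fin n) ℝ) : ℝ :=
  sSup (margin A '' {x : Fin n → ℝ | l1norm x = 1})

/-- `H` is a hard core for `A`. -/
def IsHardCore (A : Matrix (Fin m) (Fin n) ℝ) (H : Finset (Fin m)) : Prop :=
  (∃ x : Fin n → ℝ, (∀ i ∉ H, (A *ᵥ x) i < 0) ∧ ∀ i ∈ H, (A *ᵥ x) i = 0) ∧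
    ∀ x : Fin n → ℝ, (∃ i ∈ H, (A *ᵥ x) i < 0) → ∃ k ∈ H, 0 < (A *ᵥ x) k

/-- `Aᵀ ∇𝓛(A x)`. Its sup norm is `‖colGrad A ℓ x‖`, since `Fin n → ℝ` carries the sup norm. -/
def colGrad (A : Matrix (Fin m) (Fin n) ℝ) (ℓ : ℝ → ℝ) (x : Fin n → ℝ) : Fin n → ℝ :=
  Aᵀ *ᵥ riskGrad ℓ (A *ᵥ x)

/-- `γ_t` for the step that starts from `x`. -/
def stepGamma (A : Matrix (Fin m) (Fin n) ℝ) (ℓ : ℝ → ℝ) (x : Fin n → ℝ) : ℝ :=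
  ‖colGrad A ℓ x‖ / l1norm (riskGrad ℓ (A *ᵥ x))

/-- `C_t = C_ℓ(ℓ⁻¹(m 𝓛(A x)))` for the step that starts from `x`. A loss of the class `𝕃` is a
bijection from `ℝ` onto the positive reals, so `Function.invFun` is its inverse there. -/
def stepConst (A : Matrix (Fin m) (Fin n) ℝ) (ℓ : ℝ → ℝ) (x : Fin n → ℝ) : ℝ :=
  (lossConst ℓ (Function.invFun ℓ (m * risk ℓ (A *ᵥ x)))).toReal

/-- The four step size rules. -/
inductive StepRule
  | quadUpper
  | wolfe
  | adaBoost
  | optimal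

/-- `α` is a step size allowed by the rule with shrinkage `ν`, at `x` in direction `v`. -/
def IsStepSize (A : Matrix (Fin m) (Fin n) ℝ) (ℓ : ℝ → ℝ) (ν : ℝ) (x v : Fin n → ℝ) (α : ℝ) :
    StepRule → Prop
  | .quadUpper => α = ν * stepGamma A ℓ x / stepConst A ℓ x ^ 4
  | .wolfe =>
      risk ℓ (A *ᵥ (x + α • v)) ≤ risk ℓ (A *ᵥ x) - α * (1 - ν / 2) * ‖colGrad A ℓ x‖ ∧
      riskGrad ℓ (A *ᵥ (x + α • v)) ⬝ᵥ (A *ᵥ v) ≥ -(1 - ν / 4) * ‖colGrad A ℓ x‖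
  | .adaBoost =>
      -- the case `γ_t = 1`, where the formula is meaningless, is excluded
      stepGamma A ℓ x < 1 ∧
      α = ν / 2 * Real.log ((1 + stepGamma A ℓ x) / (1 - stepGamma A ℓ x))
  | .optimal =>
      ∃ α₁ : ℝ, IsMinOn (fun β : ℝ => risk ℓ (A *ᵥ (x + β • v))) Set.univ α₁ ∧ α = ν * α₁

/-- `v` is a signed coordinate vector of a column that maximises `|∇𝓛(A x)ᵀ A e_j|`, signed such
that `∇𝓛(A x)ᵀ A v = -‖∇𝓛(A x)ᵀ A‖_∞`. -/
def IsDirection (A : Matrix (Fin m) (Fin n) ℝ) (ℓ : ℝ → ℝ) (x v : Fin n → ℝ) : Prop :=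
  ∃ j : Fin n, (∀ k, |colGrad A ℓ x k| ≤ |colGrad A ℓ x j|) ∧
    (v = Pi.single j 1 ∨ v = -Pi.single j 1) ∧
    riskGrad ℓ (A *ᵥ x) ⬝ᵥ (A *ᵥ v) = -‖colGrad A ℓ x‖

/-- `x 0, x 1, …` is a sequence of iterates of the boosting algorithm, with arbitrary tie-breaking,
directions `v` and step sizes `α` consistent with the given rule. The step from `x t` to
`x (t + 1)` is the step number `t + 1` of the algorithm. -/
structure IsBoostRun (A : Matrix (Fin m) (Fin n) ℝ) (ℓ : ℝ → ℝ) (ν : ℝ) (rule : StepRule)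
    (x v : ℕ → Fin n → ℝ) (α : ℕ → ℝ) : Prop where
  init : x 0 = 0
  direction : ∀ t, IsDirection A ℓ (x t) (v t)
  stepSize : ∀ t, IsStepSize A ℓ ν (x t) (v t) (α t) rule
  update : ∀ t, x (t + 1) = x t + α t • v t

end Boosting

end

/-! On a half-line `(-∞, z]` a loss in `𝕃` is comparable to its first two derivatives, so along the
chosen direction the risk is convex with curvature at most `C_t ^ 4 * ‖∇𝓛‖₁` as long as it stays
below its current value. Hence every step size rule decreases the risk by at least a multiple of
`‖Aᵀ∇𝓛‖∞² / 𝓛`; for AdaBoost this is because, for the exponential loss and a binary matrix, its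
step is a shrunk exact line search.

A hard core `H` exists for every `A`. On the rows in `H` the predictions are bounded on sublevel
sets, and on the other rows they can all be pushed to `-∞` along a fixed direction that does not
change the rows in `H`. Moving towards a competitor on `H` and along this direction elsewhere bounds
the suboptimality `δ` by a multiple of `‖Aᵀ∇𝓛‖∞`, which gives `δ' ≤ δ - c * δ ^ 2` and the rate
`1 / t`. If `H` is empty the same argument bounds the risk itself, and if `H` contains all rows the
risk is strongly convex on sublevel sets as a function of the predictions; in both cases `δ * 𝓛` is
at most a multiple of `‖Aᵀ∇𝓛‖∞²`, so `δ' ≤ (1 - c) * δ`. A positive margin makes `H` empty, and an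
attained infimum forces `H` to contain all rows.
-/

namespace Boosting

section OneVariable

theorem add_mul_sub_add_sq_le {φ φ' φ'' : ℝ → ℝ} {S : Set ℝ} {μ x y : ℝ} (hS : Convex ℝ S)
    (hφ : ∀ a, HasDerivAt φ (φ' a) a) (hφ' : ∀ a, HasDerivAt φ' (φ'' a) a)
    (hμ : ∀ a ∈ S, μ ≤ φ'' a) (hx : x ∈ S) (hy : y ∈ S) :
    φ x + φ' x * (y - x) + μ / 2 * (y - x) ^ 2 ≤ φ y := by
  have hψ : ∀ a, HasDerivAt (fun a => φ a - μ / 2 * a ^ 2) (φ' a - μ * a) a := fun a =>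
    ((hφ a).sub ((hasDerivAt_pow 2 a).const_mul (μ / 2))).congr_deriv (by norm_num; ring)
  have hψ' : ∀ a, HasDerivAt (fun a => φ' a - μ * a) (φ'' a - μ) a := fun a =>
    ((hφ' a).sub ((hasDerivAt_id a).const_mul μ)).congr_deriv (by simp)
  have hconv : ConvexOn ℝ S fun a => φ a - μ / 2 * a ^ 2 :=
    convexOn_of_hasDerivWithinAt2_nonneg hS
      (fun a _ => (hψ a).continuousAt.continuousWithinAt)
      (fun a _ => (hψ a).hasDerivWithinAt) (fun a _ => (hψ' a).hasDerivWithinAt)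
      fun a ha => sub_nonneg.2 (hμ a (interior_subset ha))
  rcases lt_trichotomy x y with h | rfl | h
  · have := hconv.le_slope_of_hasDerivAt hx hy h (hψ x)
    rw [slope_def_field, le_div_iff₀ (sub_pos.2 h)] at this
    linarith
  · simp
  · have := hconv.slope_le_of_hasDerivAt hy hx h (hψ x)
    rw [slope_def_field, div_le_iff₀ (sub_pos.2 h)] at this
    linarith

/-- Second-order data of a convex function on the ray `[0, ∞)` whose curvature is at most `M` on
the sublevel set of its value at `0`; `φ'` and `φ''` stand for the derivatives. Line searches are
analysed for this class. -/
structure SmoothOnSublevel (φ φ' φ'' : ℝ → ℝ) (M : ℝ) : Prop where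
  hasDerivAt : ∀ a, HasDerivAt φ (φ' a) a
  hasDerivAt_deriv : ∀ a, HasDerivAt φ' (φ'' a) a
  deriv2_nonneg : ∀ a, 0 ≤ φ'' a
  curvature_pos : 0 < M
  deriv2_le : ∀ a, 0 ≤ a → φ a ≤ φ 0 → φ'' a ≤ M

namespace SmoothOnSublevel

variable {φ φ' φ'' : ℝ → ℝ} {M b : ℝ}

theorem add_mul_sub_le (h : SmoothOnSublevel φ φ' φ'' M) (x y : ℝ) :
    φ x + φ' x * (y - x) ≤ φ y := by
  simpa using add_mul_sub_add_sq_le convex_univ h.hasDerivAt h.hasDerivAt_deriv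
    (fun a _ => h.deriv2_nonneg a) (Set.mem_univ x) (Set.mem_univ y)

theorem monotone_deriv (h : SmoothOnSublevel φ φ' φ'' M) : Monotone φ' :=
  monotone_of_hasDerivAt_nonneg h.hasDerivAt_deriv h.deriv2_nonneg

theorem convexOn (h : SmoothOnSublevel φ φ' φ'' M) : ConvexOn ℝ Set.univ φ :=
  convexOn_of_hasDerivWithinAt2_nonneg convex_univ
    (fun a _ => (h.hasDerivAt a).continuousAt.continuousWithinAt)
    (fun a _ => (h.hasDerivAt a).hasDerivWithinAt)
    (fun a _ => (h.hasDerivAt_deriv a).hasDerivWithinAt) fun a _ => h.deriv2_nonneg a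

theorem deriv2_le_of_le (h : SmoothOnSublevel φ φ' φ'' M) (hφb : φ b ≤ φ 0) :
    ∀ a ∈ Set.Icc 0 b, φ'' a ≤ M := fun a ha =>
  h.deriv2_le a ha.1
    ((h.convexOn.le_max_of_mem_Icc (Set.mem_univ 0) (Set.mem_univ b) ha).trans_eq (max_eq_left hφb))

theorem deriv_le (h : SmoothOnSublevel φ φ' φ'' M) (hb : 0 ≤ b) (hφb : φ b ≤ φ 0) :
    φ' b ≤ φ' 0 + M * b := by
  have hle : φ' b - φ' 0 ≤ M * (b - 0) := by
    refine (convex_Icc 0 b).image_sub_le_mul_sub_of_deriv_le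
      (fun a _ => (h.hasDerivAt_deriv a).continuousAt.continuousWithinAt)
      (fun a _ => (h.hasDerivAt_deriv a).differentiableAt.differentiableWithinAt)
      (fun a ha => ?_) 0 ⟨le_rfl, hb⟩ b ⟨hb, le_rfl⟩ hb
    rw [(h.hasDerivAt_deriv a).deriv]
    exact h.deriv2_le_of_le hφb a (interior_subset ha)
  linarith

theorem deriv_nonpos (h : SmoothOnSublevel φ φ' φ'' M) (hb : 0 ≤ b) (hMb : M * b ≤ -φ' 0) :
    φ' b ≤ 0 := by
  by_contra! hpos
  have h0 : φ' 0 ≤ 0 := by linarith [mul_nonneg h.curvature_pos.le hb]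
  obtain ⟨c, hc, hφ'c⟩ : (0 : ℝ) ∈ φ' '' Set.Icc 0 b :=
    intermediate_value_Icc hb
      (fun a _ => (h.hasDerivAt_deriv a).continuousAt.continuousWithinAt) ⟨h0, hpos.le⟩
  have hφc : φ c ≤ φ 0 := by simpa [hφ'c] using h.add_mul_sub_le c 0
  have hcb : c < b := hc.2.lt_of_ne (by rintro rfl; exact hpos.ne' hφ'c)
  have := h.deriv_le hc.1 hφc
  linarith [mul_lt_mul_of_pos_left hcb h.curvature_pos]

theorem le_quadratic (h : SmoothOnSublevel φ φ' φ'' M) (hb : 0 ≤ b) (hMb : M * b ≤ -φ' 0) :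
    φ b ≤ φ 0 + φ' 0 * b + M / 2 * b ^ 2 := by
  have hφb : φ b ≤ φ 0 := by
    have := h.add_mul_sub_le b 0
    linarith [mul_nonneg_of_nonpos_of_nonpos (h.deriv_nonpos hb hMb) (neg_nonpos.2 hb)]
  have := add_mul_sub_add_sq_le (φ := fun a => -φ a) (convex_Icc 0 b)
    (fun a => (h.hasDerivAt a).neg) (fun a => (h.hasDerivAt_deriv a).neg)
    (fun a ha => neg_le_neg (h.deriv2_le_of_le hφb a ha)) ⟨le_rfl, hb⟩ ⟨hb, le_rfl⟩
  linarith

theorem apply_shrunk_newton_le (h : SmoothOnSublevel φ φ' φ'' M) {ν : ℝ} (hν0 : 0 ≤ ν)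
    (hν1 : ν ≤ 1) (h0 : φ' 0 ≤ 0) :
    φ (ν * -φ' 0 / M) ≤ φ 0 - ν * φ' 0 ^ 2 / (2 * M) := by
  have hM := h.curvature_pos
  have hle := h.le_quadratic (b := ν * -φ' 0 / M)
    (div_nonneg (mul_nonneg hν0 (neg_nonneg.2 h0)) hM.le)
    (by rw [mul_div_cancel₀ _ hM.ne']; exact mul_le_of_le_one_left (neg_nonneg.2 h0) hν1)
  have hgap : φ 0 - ν * φ' 0 ^ 2 / (2 * M) -
      (φ 0 + φ' 0 * (ν * -φ' 0 / M) + M / 2 * (ν * -φ' 0 / M) ^ 2) =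
      ν * (1 - ν) * φ' 0 ^ 2 / (2 * M) := by
    field_simp
    ring
  have : 0 ≤ ν * (1 - ν) * φ' 0 ^ 2 / (2 * M) := by
    have := sub_nonneg.2 hν1
    positivity
  linarith

theorem apply_shrunk_argmin_le (h : SmoothOnSublevel φ φ' φ'' M) {ν β : ℝ} (hν0 : 0 ≤ ν)
    (hν1 : ν ≤ 1) (h0 : φ' 0 ≤ 0) (hβ : IsMinOn φ Set.univ β) :
    φ (ν * β) ≤ φ 0 - ν * φ' 0 ^ 2 / (2 * M) := by
  have hmin : φ β ≤ φ 0 - φ' 0 ^ 2 / (2 * M) := by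
    have := h.apply_shrunk_newton_le zero_le_one le_rfl h0
    simp only [one_mul] at this
    exact (isMinOn_univ_iff.1 hβ _).trans this
  have hconv : φ (ν * β) ≤ (1 - ν) * φ 0 + ν * φ β := by
    simpa using h.convexOn.2 (Set.mem_univ 0) (Set.mem_univ β) (sub_nonneg.2 hν1) hν0 (by ring)
  calc φ (ν * β) ≤ (1 - ν) * φ 0 + ν * (φ 0 - φ' 0 ^ 2 / (2 * M)) := by
        linarith [mul_le_mul_of_nonneg_left hmin hν0]
    _ = φ 0 - ν * φ' 0 ^ 2 / (2 * M) := by ring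

theorem apply_le_of_wolfe (h : SmoothOnSublevel φ φ' φ'' M) {c₁ c₂ : ℝ} (hc₁ : 0 ≤ c₁)
    (hc₂ : c₂ < 1) (h0 : φ' 0 ≤ 0) (hdecrease : φ b ≤ φ 0 + c₁ * b * φ' 0)
    (hcurvature : c₂ * φ' 0 ≤ φ' b) :
    φ b ≤ φ 0 - c₁ * (1 - c₂) * φ' 0 ^ 2 / M := by
  have hM := h.curvature_pos
  rcases h0.eq_or_lt with h0' | hneg
  · simpa [h0'] using hdecrease
  have hb : 0 < b := by
    by_contra! hb
    have := h.monotone_deriv hb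
    linarith [mul_neg_of_pos_of_neg (sub_pos.2 hc₂) hneg]
  have hφb : φ b ≤ φ 0 := by
    linarith [mul_nonpos_of_nonneg_of_nonpos (mul_nonneg hc₁ hb.le) h0]
  have hlong : (1 - c₂) * -φ' 0 / M ≤ b := by
    rw [div_le_iff₀ hM]
    linarith [h.deriv_le hb.le hφb]
  calc φ b ≤ φ 0 - c₁ * (-φ' 0) * b := by linarith
    _ ≤ φ 0 - c₁ * (-φ' 0) * ((1 - c₂) * -φ' 0 / M) := by
        gcongr
        exact mul_nonneg hc₁ (neg_nonneg.2 h0)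
    _ = φ 0 - c₁ * (1 - c₂) * φ' 0 ^ 2 / M := by ring

end SmoothOnSublevel

end OneVariable

section Recurrence

variable {δ : ℕ → ℝ} {c q : ℝ}

theorem mul_succ_le_one_of_succ_le_sub_sq (hδ : ∀ t, 0 ≤ δ t) (hc : 0 < c)
    (hstep : ∀ t, δ (t + 1) ≤ δ t - c * δ t ^ 2) (t : ℕ) : c * δ t * (t + 1) ≤ 1 := by
  have hnonneg : ∀ t, 0 ≤ c * δ t := fun t => mul_nonneg hc.le (hδ t)
  have hsucc : ∀ t, c * δ (t + 1) ≤ c * δ t * (1 - c * δ t) := fun t => by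
    linarith [mul_le_mul_of_nonneg_left (hstep t) hc.le]
  have hle_one : ∀ t, c * δ t ≤ 1 := fun t => by
    by_contra! h
    have : c * δ t * (1 - c * δ t) < 0 := mul_neg_of_pos_of_neg (by linarith) (by linarith)
    linarith [hsucc t, hnonneg (t + 1)]
  induction t with
  | zero => simpa using hle_one 0
  | succ t ih =>
    push_cast
    calc c * δ (t + 1) * (t + 1 + 1) ≤ c * δ t * (1 - c * δ t) * (t + 1 + 1) :=
          mul_le_mul_of_nonneg_right (hsucc t) (by positivity)
      _ = (c * δ t * (t + 1)) * (1 - c * δ t) + c * δ t * (1 - c * δ t) := by ring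
      _ ≤ 1 * (1 - c * δ t) + c * δ t * (1 - c * δ t) := by
          gcongr
          exact sub_nonneg.2 (hle_one t)
      _ = 1 - (c * δ t) ^ 2 := by ring
      _ ≤ 1 := sub_le_self _ (sq_nonneg _)

theorem le_of_succ_le_sub_sq (hδ : ∀ t, 0 ≤ δ t) (hc : 0 < c)
    (hstep : ∀ t, δ (t + 1) ≤ δ t - c * δ t ^ 2) {ε : ℝ} (hε : 0 < ε) {t : ℕ}
    (ht : 1 / c * (1 / ε) ≤ t) : δ t ≤ ε := by
  have ht' : 1 ≤ c * ε * t := by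
    rw [one_div_mul_one_div, div_le_iff₀ (by positivity)] at ht
    linarith
  by_contra! hlt
  have hrate := mul_succ_le_one_of_succ_le_sub_sq hδ hc hstep t
  have : c * ε * (t + 1) < c * δ t * (t + 1) := by gcongr
  linarith [mul_pos hc hε]

theorem le_mul_exp_of_succ_le_sub_mul (hδ : ∀ t, 0 ≤ δ t)
    (hstep : ∀ t, δ (t + 1) ≤ δ t - q * δ t) (t : ℕ) : δ t ≤ δ 0 * Real.exp (-(q * t)) := by
  induction t with
  | zero => simp
  | succ t ih =>
    calc δ (t + 1) ≤ δ t * (-q + 1) := by linarith [hstep t]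
      _ ≤ δ t * Real.exp (-q) := mul_le_mul_of_nonneg_left (Real.add_one_le_exp _) (hδ t)
      _ ≤ δ 0 * Real.exp (-(q * t)) * Real.exp (-q) := by gcongr
      _ = δ 0 * Real.exp (-(q * (t + 1 : ℕ))) := by
        rw [mul_assoc, ← Real.exp_add]
        push_cast
        ring_nf

theorem le_of_succ_le_sub_mul (hδ : ∀ t, 0 ≤ δ t) (hq : 0 < q)
    (hstep : ∀ t, δ (t + 1) ≤ δ t - q * δ t) {D : ℝ} (hD : 0 < D) (hδ0 : δ 0 ≤ D) {ε : ℝ}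
    (hε : 0 < ε) {t : ℕ} (ht : (|Real.log D| + 1) / q * max 1 (Real.log (1 / ε)) ≤ t) :
    δ t ≤ ε := by
  have hlog : Real.log D + Real.log (1 / ε) ≤ q * t := by
    calc Real.log D + Real.log (1 / ε)
        ≤ |Real.log D| * max 1 (Real.log (1 / ε)) + max 1 (Real.log (1 / ε)) := by
          gcongr
          · exact (le_abs_self _).trans
              (le_mul_of_one_le_right (abs_nonneg _) (le_max_left _ _))
          · exact le_max_right _ _
      _ ≤ q * t := by
          rw [div_mul_eq_mul_div, div_le_iff₀ hq] at ht
          linarith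
  rw [one_div, Real.log_inv] at hlog
  calc δ t ≤ δ 0 * Real.exp (-(q * t)) := le_mul_exp_of_succ_le_sub_mul hδ hstep t
    _ ≤ Real.exp (Real.log D) * Real.exp (-(q * t)) := by rw [Real.exp_log hD]; gcongr
    _ = Real.exp (Real.log D - q * t) := by rw [← Real.exp_add, sub_eq_add_neg]
    _ ≤ Real.exp (Real.log ε) := Real.exp_le_exp.2 (by linarith)
    _ = ε := Real.exp_log hε

end Recurrence

section Loss

variable {ℓ : ℝ → ℝ} {x y z : ℝ}

namespace IsLossBound

variable {c : ℝ≥0} {i : ℕ}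

theorem exp_div_pos (h : IsLossBound ℓ z c) (hx : x ≤ z) (hi : i ≤ 2) :
    0 < Real.exp x / iteratedDeriv i ℓ x :=
  have hc : 0 < c := zero_lt_one.trans_le h.1
  lt_of_lt_of_le (by positivity) (h.2 x hx i (by grind)).1

theorem iteratedDeriv_pos (h : IsLossBound ℓ z c) (hx : x ≤ z) (hi : i ≤ 2) :
    0 < iteratedDeriv i ℓ x :=
  (div_pos_iff_of_pos_left (Real.exp_pos x)).1 (h.exp_div_pos hx hi)

theorem exp_le_mul_iteratedDeriv (h : IsLossBound ℓ z c) (hx : x ≤ z) (hi : i ≤ 2) :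
    Real.exp x ≤ c * iteratedDeriv i ℓ x :=
  (div_le_iff₀ (h.iteratedDeriv_pos hx hi)).1 (h.2 x hx i (by grind)).2

theorem iteratedDeriv_le_mul_exp (h : IsLossBound ℓ z c) (hx : x ≤ z) (hi : i ≤ 2) :
    iteratedDeriv i ℓ x ≤ c * Real.exp x := by
  have hc : (0 : ℝ) < c := zero_lt_one.trans_le h.1
  have := (h.2 x hx i (by grind)).1
  rwa [le_div_iff₀ (h.iteratedDeriv_pos hx hi), inv_mul_le_iff₀ hc] at this

theorem iteratedDeriv_le_sq_mul (h : IsLossBound ℓ z c) (hx : x ≤ z) {j : ℕ} (hi : i ≤ 2)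
    (hj : j ≤ 2) : iteratedDeriv i ℓ x ≤ c ^ 2 * iteratedDeriv j ℓ x :=
  calc iteratedDeriv i ℓ x ≤ c * Real.exp x := h.iteratedDeriv_le_mul_exp hx hi
    _ ≤ c * (c * iteratedDeriv j ℓ x) := by
        gcongr
        exact h.exp_le_mul_iteratedDeriv hx hj
    _ = c ^ 2 * iteratedDeriv j ℓ x := by ring

end IsLossBound

theorem lossConst_mono (h : y ≤ z) : lossConst ℓ y ≤ lossConst ℓ z :=
  le_iInf₂ fun c hc => iInf₂_le c ⟨hc.1, fun x hx => hc.2 x (hx.trans h)⟩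

theorem exists_isLossBound (h : lossConst ℓ z ≠ ⊤) : ∃ c, IsLossBound ℓ z c := by
  have := h.lt_top
  simp only [lossConst, iInf_lt_iff] at this
  obtain ⟨c, hc, -⟩ := this
  exact ⟨c, hc⟩

theorem le_toReal_lossConst (h : lossConst ℓ z ≠ ⊤) {a : ℝ}
    (ha : ∀ c : ℝ≥0, IsLossBound ℓ z c → a ≤ c) : a ≤ (lossConst ℓ z).toReal := by
  rw [← ENNReal.ofReal_le_iff_le_toReal h]
  refine le_iInf₂ fun c hc => ?_
  rw [← ENNReal.ofReal_coe_nnreal]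
  exact ENNReal.ofReal_le_ofReal (ha c hc)

theorem isLossBound_lossConst (h : lossConst ℓ z ≠ ⊤) :
    IsLossBound ℓ z (lossConst ℓ z).toNNReal := by
  obtain ⟨c₀, hc₀⟩ := exists_isLossBound h
  refine ⟨?_, fun x hx i hi => ?_⟩
  · rw [← NNReal.coe_le_coe]
    exact le_toReal_lossConst h fun c hc => hc.1
  · have hpos := hc₀.exp_div_pos hx (show i ≤ 2 by grind)
    have hle : Real.exp x / iteratedDeriv i ℓ x ≤ (lossConst ℓ z).toReal :=
      le_toReal_lossConst h fun c hc => (hc.2 x hx i hi).2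
    refine ⟨(inv_le_comm₀ (hpos.trans_le hle) hpos).2 ?_, hle⟩
    exact le_toReal_lossConst h fun c hc =>
      (inv_le_comm₀ (NNReal.coe_pos.2 (zero_lt_one.trans_le hc.1)) hpos).1 (hc.2 x hx i hi).1

namespace LossClass

theorem isLossBound (hℓ : LossClass ℓ) (z : ℝ) : IsLossBound ℓ z (lossConst ℓ z).toNNReal :=
  isLossBound_lossConst (hℓ.lossConst_lt_top z).ne

theorem one_le_lossConst (hℓ : LossClass ℓ) (z : ℝ) : 1 ≤ (lossConst ℓ z).toReal :=
  (hℓ.isLossBound z).1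

theorem pos (hℓ : LossClass ℓ) (x : ℝ) : 0 < ℓ x := by
  simpa using (hℓ.isLossBound x).iteratedDeriv_pos le_rfl zero_le_two

theorem deriv_pos (hℓ : LossClass ℓ) (x : ℝ) : 0 < deriv ℓ x := by
  simpa using (hℓ.isLossBound x).iteratedDeriv_pos le_rfl one_le_two

theorem deriv_deriv_pos (hℓ : LossClass ℓ) (x : ℝ) : 0 < deriv (deriv ℓ) x := by
  simpa [iteratedDeriv_succ] using (hℓ.isLossBound x).iteratedDeriv_pos le_rfl le_rfl

theorem le_mul_deriv (hℓ : LossClass ℓ) (h : x ≤ z) :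
    ℓ x ≤ (lossConst ℓ z).toReal ^ 2 * deriv ℓ x := by
  simpa [ENNReal.coe_toNNReal_eq_toReal] using
    (hℓ.isLossBound z).iteratedDeriv_le_sq_mul h zero_le_two one_le_two

theorem deriv_le_mul (hℓ : LossClass ℓ) (h : x ≤ z) :
    deriv ℓ x ≤ (lossConst ℓ z).toReal ^ 2 * ℓ x := by
  simpa [ENNReal.coe_toNNReal_eq_toReal] using
    (hℓ.isLossBound z).iteratedDeriv_le_sq_mul h one_le_two zero_le_two

theorem deriv_deriv_le_mul (hℓ : LossClass ℓ) (h : x ≤ z) :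
    deriv (deriv ℓ) x ≤ (lossConst ℓ z).toReal ^ 2 * ℓ x := by
  simpa [iteratedDeriv_succ, ENNReal.coe_toNNReal_eq_toReal] using
    (hℓ.isLossBound z).iteratedDeriv_le_sq_mul h le_rfl zero_le_two

theorem differentiable (hℓ : LossClass ℓ) : Differentiable ℝ ℓ :=
  hℓ.contDiff.differentiable two_ne_zero

theorem contDiff_deriv (hℓ : LossClass ℓ) : ContDiff ℝ 1 (deriv ℓ) :=
  ((contDiff_succ_iff_deriv (n := 1)).1 hℓ.contDiff).2.2

theorem differentiable_deriv (hℓ : LossClass ℓ) : Differentiable ℝ (deriv ℓ) :=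
  hℓ.contDiff_deriv.differentiable one_ne_zero

theorem continuous_deriv_deriv (hℓ : LossClass ℓ) : Continuous (deriv (deriv ℓ)) :=
  hℓ.contDiff_deriv.continuous_deriv le_rfl

theorem strictMono (hℓ : LossClass ℓ) : StrictMono ℓ :=
  strictMono_of_deriv_pos hℓ.deriv_pos

theorem add_deriv_mul_sub_add_sq_le (hℓ : LossClass ℓ) {S : Set ℝ} {μ : ℝ} (hS : Convex ℝ S)
    (hμ : ∀ a ∈ S, μ ≤ deriv (deriv ℓ) a) (hx : x ∈ S) (hy : y ∈ S) :
    ℓ x + deriv ℓ x * (y - x) + μ / 2 * (y - x) ^ 2 ≤ ℓ y :=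
  add_mul_sub_add_sq_le hS (fun a => (hℓ.differentiable a).hasDerivAt)
    (fun a => (hℓ.differentiable_deriv a).hasDerivAt) hμ hx hy

theorem add_deriv_mul_sub_le (hℓ : LossClass ℓ) (x y : ℝ) : ℓ x + deriv ℓ x * (y - x) ≤ ℓ y := by
  simpa using hℓ.add_deriv_mul_sub_add_sq_le convex_univ (fun a _ => (hℓ.deriv_deriv_pos a).le)
    (Set.mem_univ x) (Set.mem_univ y)

theorem tendsto_atBot (hℓ : LossClass ℓ) : Filter.Tendsto ℓ Filter.atBot (nhds 0) := by
  have hexp :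
      Filter.Tendsto (fun x => (lossConst ℓ 0).toReal * Real.exp x) Filter.atBot (nhds 0) := by
    simpa using Real.tendsto_exp_atBot.const_mul (lossConst ℓ 0).toReal
  refine squeeze_zero' (Filter.Eventually.of_forall hℓ.nonneg) ?_ hexp
  filter_upwards [Filter.eventually_le_atBot 0] with x hx
  simpa [ENNReal.coe_toNNReal_eq_toReal] using
    (hℓ.isLossBound 0).iteratedDeriv_le_mul_exp hx zero_le_two

theorem tendsto_atTop (hℓ : LossClass ℓ) : Filter.Tendsto ℓ Filter.atTop Filter.atTop := by
  refine Filter.tendsto_atTop_mono (fun y => hℓ.add_deriv_mul_sub_le 0 y) ?_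
  simpa using Filter.tendsto_atTop_add_const_left _ (ℓ 0)
    (Filter.tendsto_id.const_mul_atTop (hℓ.deriv_pos 0))

theorem apply_invFun (hℓ : LossClass ℓ) (hy : 0 < y) : ℓ (Function.invFun ℓ y) = y := by
  obtain ⟨a, ha⟩ := (hℓ.tendsto_atBot.eventually_lt_const hy).exists
  obtain ⟨b, hb⟩ := (hℓ.tendsto_atTop.eventually_ge_atTop y).exists
  exact Function.invFun_eq (mem_range_of_exists_le_of_exists_ge hℓ.contDiff.continuous
    ⟨a, ha.le⟩ ⟨b, hb⟩)

theorem le_invFun_iff (hℓ : LossClass ℓ) (hy : 0 < y) : x ≤ Function.invFun ℓ y ↔ ℓ x ≤ y := by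
  rw [← hℓ.strictMono.le_iff_le, hℓ.apply_invFun hy]

end LossClass

end Loss

section Risk

variable {m : ℕ} {ℓ : ℝ → ℝ}

theorem card_mul_risk (hm : 0 < m) (z : Fin m → ℝ) : m * risk ℓ z = ∑ i, ℓ (z i) :=
  mul_inv_cancel_left₀ (Nat.cast_ne_zero.2 hm.ne') _

theorem riskGrad_apply (hℓ : Differentiable ℝ ℓ) (z : Fin m → ℝ) (i : Fin m) :
    riskGrad ℓ z i = (m : ℝ)⁻¹ * deriv ℓ (z i) := by
  have h : HasFDerivAt (risk ℓ) ((m : ℝ)⁻¹ • ∑ i : Fin m,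
      deriv ℓ (z i) • (ContinuousLinearMap.proj i : (Fin m → ℝ) →L[ℝ] ℝ)) z :=
    (HasFDerivAt.fun_sum fun i _ =>
      (hℓ (z i)).hasDerivAt.comp_hasFDerivAt z (hasFDerivAt_apply i z)).const_mul _
  rw [riskGrad, h.fderiv]
  simp [Pi.single_apply]

theorem riskGrad_dotProduct (hℓ : Differentiable ℝ ℓ) (z q : Fin m → ℝ) :
    riskGrad ℓ z ⬝ᵥ q = (m : ℝ)⁻¹ * ∑ i, deriv ℓ (z i) * q i := by
  simp only [dotProduct, riskGrad_apply hℓ, Finset.mul_sum, mul_assoc]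

theorem l1norm_riskGrad (hℓ : Differentiable ℝ ℓ) (hmono : Monotone ℓ) (z : Fin m → ℝ) :
    l1norm (riskGrad ℓ z) = (m : ℝ)⁻¹ * ∑ i, deriv ℓ (z i) := by
  simp only [l1norm, riskGrad_apply hℓ, Finset.mul_sum]
  exact Finset.sum_congr rfl fun i _ =>
    abs_of_nonneg (mul_nonneg (inv_nonneg.2 m.cast_nonneg) hmono.deriv_nonneg)

theorem hasDerivAt_risk_add_smul (hℓ : Differentiable ℝ ℓ) (p q : Fin m → ℝ) (a : ℝ) :
    HasDerivAt (fun a : ℝ => risk ℓ (p + a • q)) (riskGrad ℓ (p + a • q) ⬝ᵥ q) a := by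
  rw [riskGrad_dotProduct hℓ]
  refine HasDerivAt.const_mul _ (HasDerivAt.fun_sum fun i _ => ?_)
  have hline : HasDerivAt (fun a : ℝ => (p + a • q) i) (q i) a := by
    simpa using ((hasDerivAt_id a).mul_const (q i)).const_add (p i)
  exact (hℓ _).hasDerivAt.comp a hline

theorem hasDerivAt_riskGrad_add_smul_dotProduct (hℓ : Differentiable ℝ ℓ)
    (hℓ' : Differentiable ℝ (deriv ℓ)) (p q : Fin m → ℝ) (a : ℝ) :
    HasDerivAt (fun a : ℝ => riskGrad ℓ (p + a • q) ⬝ᵥ q)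
      ((m : ℝ)⁻¹ * ∑ i, deriv (deriv ℓ) ((p + a • q) i) * q i ^ 2) a := by
  simp only [riskGrad_dotProduct hℓ]
  refine HasDerivAt.const_mul _ (HasDerivAt.fun_sum fun i _ => ?_)
  have hline : HasDerivAt (fun a : ℝ => (p + a • q) i) (q i) a := by
    simpa using ((hasDerivAt_id a).mul_const (q i)).const_add (p i)
  exact (((hℓ' _).hasDerivAt.comp a hline).mul_const (q i)).congr_deriv (by ring)

/-- The constant `C_ℓ(ℓ⁻¹(m r))`. Each coordinate of a point of risk at most `r` is at most
`ℓ⁻¹(m r)`, so on the sublevel set `𝓛 ≤ r` this constant compares `ℓ`, `ℓ'` and `ℓ''`. -/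
noncomputable def levelConst (m : ℕ) (ℓ : ℝ → ℝ) (r : ℝ) : ℝ :=
  (lossConst ℓ (Function.invFun ℓ (m * r))).toReal

namespace LossClass

variable {w p q : Fin m → ℝ} {r s : ℝ}

theorem risk_pos (hℓ : LossClass ℓ) (hm : 0 < m) (z : Fin m → ℝ) : 0 < risk ℓ z := by
  have : NeZero m := ⟨hm.ne'⟩
  exact mul_pos (by positivity) (Finset.sum_pos (fun i _ => hℓ.pos _) Finset.univ_nonempty)

theorem one_le_levelConst (hℓ : LossClass ℓ) (m : ℕ) (r : ℝ) : 1 ≤ levelConst m ℓ r :=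
  hℓ.one_le_lossConst _

theorem le_invFun_of_risk_le (hℓ : LossClass ℓ) (hm : 0 < m) (h : risk ℓ w ≤ r) (i : Fin m) :
    w i ≤ Function.invFun ℓ (m * r) := by
  have hr : 0 < r := (hℓ.risk_pos hm w).trans_le h
  refine (hℓ.le_invFun_iff (by positivity)).2 ?_
  calc ℓ (w i) ≤ ∑ j, ℓ (w j) :=
        Finset.single_le_sum (f := fun j => ℓ (w j)) (fun j _ => hℓ.nonneg _) (Finset.mem_univ i)
    _ = m * risk ℓ w := (card_mul_risk hm w).symm
    _ ≤ m * r := by gcongr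

theorem levelConst_mono (hℓ : LossClass ℓ) (hm : 0 < m) (hr : 0 < r) (h : r ≤ s) :
    levelConst m ℓ r ≤ levelConst m ℓ s := by
  have hs : 0 < s := hr.trans_le h
  refine ENNReal.toReal_mono (hℓ.lossConst_lt_top _).ne (lossConst_mono ?_)
  rw [hℓ.le_invFun_iff (by positivity), hℓ.apply_invFun (by positivity)]
  gcongr

theorem risk_le_mul_l1norm (hℓ : LossClass ℓ) (hm : 0 < m) (h : risk ℓ w ≤ r) :
    risk ℓ w ≤ levelConst m ℓ r ^ 2 * l1norm (riskGrad ℓ w) := by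
  rw [l1norm_riskGrad hℓ.differentiable hℓ.strictMono.monotone, risk, mul_left_comm,
    Finset.mul_sum Finset.univ _ (_ ^ 2)]
  gcongr with i
  exact hℓ.le_mul_deriv (hℓ.le_invFun_of_risk_le hm h i)

theorem l1norm_le_mul_risk (hℓ : LossClass ℓ) (hm : 0 < m) (h : risk ℓ w ≤ r) :
    l1norm (riskGrad ℓ w) ≤ levelConst m ℓ r ^ 2 * risk ℓ w := by
  rw [l1norm_riskGrad hℓ.differentiable hℓ.strictMono.monotone, risk, mul_left_comm,
    Finset.mul_sum Finset.univ _ (_ ^ 2)]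
  gcongr with i
  exact hℓ.deriv_le_mul (hℓ.le_invFun_of_risk_le hm h i)

theorem l1norm_riskGrad_pos (hℓ : LossClass ℓ) (hm : 0 < m) (w : Fin m → ℝ) :
    0 < l1norm (riskGrad ℓ w) :=
  pos_of_mul_pos_right ((hℓ.risk_pos hm w).trans_le (hℓ.risk_le_mul_l1norm hm le_rfl))
    (sq_nonneg _)

theorem curvature_le (hℓ : LossClass ℓ) (hm : 0 < m) (h : risk ℓ w ≤ risk ℓ p)
    (hq : ∀ i, |q i| ≤ 1) : (m : ℝ)⁻¹ * ∑ i, deriv (deriv ℓ) (w i) * q i ^ 2 ≤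
      levelConst m ℓ (risk ℓ p) ^ 4 * l1norm (riskGrad ℓ p) := by
  set C := levelConst m ℓ (risk ℓ p)
  calc (m : ℝ)⁻¹ * ∑ i, deriv (deriv ℓ) (w i) * q i ^ 2
      ≤ (m : ℝ)⁻¹ * ∑ i, C ^ 2 * ℓ (w i) := by
        refine mul_le_mul_of_nonneg_left (Finset.sum_le_sum fun i _ => ?_) (by positivity)
        exact (mul_le_of_le_one_right (hℓ.deriv_deriv_pos _).le
          ((sq_le_one_iff_abs_le_one _).2 (hq i))).trans
          (hℓ.deriv_deriv_le_mul (hℓ.le_invFun_of_risk_le hm h i))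
    _ = C ^ 2 * risk ℓ w := by rw [← Finset.mul_sum, risk, mul_left_comm]
    _ ≤ C ^ 2 * (C ^ 2 * l1norm (riskGrad ℓ p)) := by
        gcongr
        exact h.trans (hℓ.risk_le_mul_l1norm hm le_rfl)
    _ = C ^ 4 * l1norm (riskGrad ℓ p) := by ring

theorem smoothOnSublevel_risk (hℓ : LossClass ℓ) (hm : 0 < m) (p : Fin m → ℝ)
    (hq : ∀ i, |q i| ≤ 1) :
    SmoothOnSublevel (fun a => risk ℓ (p + a • q)) (fun a => riskGrad ℓ (p + a • q) ⬝ᵥ q)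
      (fun a => (m : ℝ)⁻¹ * ∑ i, deriv (deriv ℓ) ((p + a • q) i) * q i ^ 2)
      (levelConst m ℓ (risk ℓ p) ^ 4 * l1norm (riskGrad ℓ p)) where
  hasDerivAt := hasDerivAt_risk_add_smul hℓ.differentiable p q
  hasDerivAt_deriv :=
    hasDerivAt_riskGrad_add_smul_dotProduct hℓ.differentiable hℓ.differentiable_deriv p q
  deriv2_nonneg a := mul_nonneg (by positivity)
    (Finset.sum_nonneg fun i _ => mul_nonneg (hℓ.deriv_deriv_pos _).le (sq_nonneg _))
  curvature_pos := mul_pos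
    (pow_pos (zero_lt_one.trans_le (hℓ.one_le_levelConst _ _)) _) (hℓ.l1norm_riskGrad_pos hm p)
  deriv2_le a _ ha := hℓ.curvature_le hm (by simpa using ha) hq

end LossClass

end Risk

section AdaBoost

variable {m n : ℕ} {A : Matrix (Fin m) (Fin n) ℝ} {x v : Fin n → ℝ}

theorem isMinOn_cosh_sub_mul_sinh {γ : ℝ} (hγ : γ ∈ Set.Ioo (-1) 1) :
    IsMinOn (fun β => Real.cosh β - γ * Real.sinh β) Set.univ (Real.artanh γ) := by
  have := Real.cosh_pos (Real.artanh γ)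
  have hformula : ∀ β, Real.cosh β - γ * Real.sinh β =
      Real.cosh (β - Real.artanh γ) / Real.cosh (Real.artanh γ) := fun β => by
    nth_rw 1 [← Real.tanh_artanh hγ]
    rw [Real.tanh_eq_sinh_div_cosh, Real.cosh_sub]
    field_simp
  refine isMinOn_univ_iff.2 fun β => ?_
  rw [hformula, hformula, sub_self, Real.cosh_zero]
  gcongr
  exact Real.one_le_cosh _

theorem risk_exp_add_smul (p : Fin m → ℝ) {q : Fin m → ℝ} (hq : ∀ i, q i = -1 ∨ q i = 1) (β : ℝ) :
    risk Real.exp (p + β • q) =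
      Real.cosh β * risk Real.exp p + Real.sinh β * (riskGrad Real.exp p ⬝ᵥ q) := by
  have hterm : ∀ i, Real.exp ((p + β • q) i) =
      Real.cosh β * Real.exp (p i) + Real.sinh β * (Real.exp (p i) * q i) := fun i => by
    simp only [Pi.add_apply, Pi.smul_apply, smul_eq_mul, Real.exp_add]
    rcases hq i with h | h
    · rw [h, mul_neg_one, ← Real.cosh_sub_sinh β]
      ring
    · rw [h, mul_one, ← Real.cosh_add_sinh β]
      ring
  rw [riskGrad_dotProduct Real.differentiable_exp, Real.deriv_exp, risk, risk]
  simp only [hterm, Finset.sum_add_distrib, ← Finset.mul_sum]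
  ring

theorem l1norm_riskGrad_exp (p : Fin m → ℝ) :
    l1norm (riskGrad Real.exp p) = risk Real.exp p := by
  rw [l1norm_riskGrad Real.differentiable_exp Real.exp_strictMono.monotone, Real.deriv_exp, risk]

theorem IsDirection.mulVec_eq {ℓ : ℝ → ℝ} (hA : ∀ i j, A i j = -1 ∨ A i j = 1)
    (hv : IsDirection A ℓ x v) (i : Fin m) : (A *ᵥ v) i = -1 ∨ (A *ᵥ v) i = 1 := by
  obtain ⟨j, -, rfl | rfl, -⟩ := hv
  · simpa using hA i j
  · rcases hA i j with h | h <;> simp [Matrix.mulVec_neg, h]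

/-- For the exponential loss and a binary matrix, AdaBoost without shrinkage is an exact line
search: on the search line the risk is a multiple of `β ↦ cosh β - γ sinh β`. -/
theorem IsDirection.isMinOn_half_log (hv : IsDirection A Real.exp x v) (hm : 0 < m)
    (hA : ∀ i j, A i j = -1 ∨ A i j = 1) (hγ : stepGamma A Real.exp x < 1) :
    IsMinOn (fun β : ℝ => risk Real.exp (A *ᵥ (x + β • v))) Set.univ
      (1 / 2 * Real.log ((1 + stepGamma A Real.exp x) / (1 - stepGamma A Real.exp x))) := by
  set γ := stepGamma A Real.exp x with hγ_def
  have : NeZero m := ⟨hm.ne'⟩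
  have hrisk : 0 < risk Real.exp (A *ᵥ x) := by
    unfold risk
    positivity
  have hγ_nonneg : 0 ≤ γ := by
    rw [hγ_def, stepGamma, l1norm_riskGrad_exp]
    positivity
  have hslope : riskGrad Real.exp (A *ᵥ x) ⬝ᵥ (A *ᵥ v) = -(γ * risk Real.exp (A *ᵥ x)) := by
    obtain ⟨-, -, -, hdot⟩ := hv
    rw [hdot, hγ_def, stepGamma, l1norm_riskGrad_exp, div_mul_cancel₀ _ hrisk.ne']
  have hline : ∀ β : ℝ, risk Real.exp (A *ᵥ (x + β • v)) =
      risk Real.exp (A *ᵥ x) * (Real.cosh β - γ * Real.sinh β) := fun β => by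
    rw [Matrix.mulVec_add, Matrix.mulVec_smul, risk_exp_add_smul _ (hv.mulVec_eq hA), hslope]
    ring
  simp only [hline]
  rw [← Real.artanh_eq_half_log ⟨by linarith, hγ.le⟩]
  exact isMinOn_univ_iff.2 fun β => mul_le_mul_of_nonneg_left
    (isMinOn_univ_iff.1 (isMinOn_cosh_sub_mul_sinh ⟨by linarith, hγ⟩) β) hrisk.le

end AdaBoost

section StepSize

variable {m n : ℕ} {ℓ : ℝ → ℝ} {A : Matrix (Fin m) (Fin n) ℝ} {x v : Fin n → ℝ} {ν : ℝ}
  {rule : StepRule}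

theorem IsDirection.abs_mulVec_le_one (hv : IsDirection A ℓ x v) (hA : ∀ i j, |A i j| ≤ 1)
    (i : Fin m) : |(A *ᵥ v) i| ≤ 1 := by
  obtain ⟨j, -, rfl | rfl, -⟩ := hv
  · simpa using hA i j
  · simpa [Matrix.mulVec_neg] using hA i j

theorem IsDirection.smoothOnSublevel_risk (hv : IsDirection A ℓ x v) (hℓ : LossClass ℓ)
    (hm : 0 < m) (hA : ∀ i j, |A i j| ≤ 1) :
    SmoothOnSublevel (fun a => risk ℓ (A *ᵥ (x + a • v)))
      (fun a => riskGrad ℓ (A *ᵥ (x + a • v)) ⬝ᵥ (A *ᵥ v))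
      (fun a => (m : ℝ)⁻¹ * ∑ i, deriv (deriv ℓ) ((A *ᵥ (x + a • v)) i) * (A *ᵥ v) i ^ 2)
      (stepConst A ℓ x ^ 4 * l1norm (riskGrad ℓ (A *ᵥ x))) := by
  simp only [Matrix.mulVec_add, Matrix.mulVec_smul]
  exact hℓ.smoothOnSublevel_risk hm (A *ᵥ x) (hv.abs_mulVec_le_one hA)

/-- The requirement on the instance for a step size rule: AdaBoost is restricted to the
exponential loss and to binary matrices. -/
def StepRule.Admissible (rule : StepRule) (A : Matrix (Fin m) (Fin n) ℝ) (ℓ : ℝ → ℝ) : Prop :=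
  rule = .adaBoost → ℓ = Real.exp ∧ ∀ i j, A i j = -1 ∨ A i j = 1

theorem IsStepSize.risk_le (hℓ : LossClass ℓ) (hm : 0 < m) (hA : ∀ i j, |A i j| ≤ 1)
    (hν0 : 0 < ν) (hν1 : ν ≤ 1) (hrule : rule.Admissible A ℓ) (hv : IsDirection A ℓ x v) {α : ℝ}
    (hα : IsStepSize A ℓ ν x v α rule) :
    risk ℓ (A *ᵥ (x + α • v)) ≤ risk ℓ (A *ᵥ x) -
      ν * ‖colGrad A ℓ x‖ ^ 2 / (8 * (stepConst A ℓ x ^ 4 * l1norm (riskGrad ℓ (A *ᵥ x)))) := by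
  have hsmooth := hv.smoothOnSublevel_risk hℓ hm hA
  obtain ⟨-, -, -, hslope⟩ := id hv
  have hM := hsmooth.curvature_pos
  have hnewton := hsmooth.apply_shrunk_newton_le hν0.le hν1
  have hargmin := fun β => hsmooth.apply_shrunk_argmin_le (β := β) hν0.le hν1
  have hwolfe := hsmooth.apply_le_of_wolfe (b := α) (c₁ := 1 - ν / 2) (c₂ := 1 - ν / 4)
    (by linarith) (by linarith)
  simp only [zero_smul, add_zero, hslope, neg_neg, neg_sq, neg_nonpos, norm_nonneg,
    forall_const] at hnewton hargmin hwolfe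
  set M := stepConst A ℓ x ^ 4 * l1norm (riskGrad ℓ (A *ᵥ x))
  have hweaken : ν * ‖colGrad A ℓ x‖ ^ 2 / (8 * M) ≤ ν * ‖colGrad A ℓ x‖ ^ 2 / (2 * M) := by
    gcongr
    norm_num
  cases rule with
  | quadUpper =>
    obtain rfl : α = ν * ‖colGrad A ℓ x‖ / M := by
      rw [show α = ν * stepGamma A ℓ x / stepConst A ℓ x ^ 4 from hα, stepGamma, mul_div_assoc,
        mul_div_assoc, div_div, mul_comm (l1norm _)]
    exact hnewton.trans (sub_le_sub_left hweaken _)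
  | wolfe =>
    refine (hwolfe (by linarith [hα.1]) (by linarith [hα.2])).trans (sub_le_sub_left ?_ _)
    calc ν * ‖colGrad A ℓ x‖ ^ 2 / (8 * M)
        = 1 / 2 * (ν / 4) * ‖colGrad A ℓ x‖ ^ 2 / M := by ring
      _ ≤ (1 - ν / 2) * (1 - (1 - ν / 4)) * ‖colGrad A ℓ x‖ ^ 2 / M := by
        gcongr <;> linarith
  | adaBoost =>
    obtain ⟨rfl, hbinary⟩ := hrule rfl
    obtain ⟨hγ, rfl⟩ := hα
    rw [div_eq_mul_one_div, mul_assoc]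
    exact (hargmin _ (hv.isMinOn_half_log hm hbinary hγ)).trans (sub_le_sub_left hweaken _)
  | optimal =>
    obtain ⟨β, hβ, rfl⟩ := hα
    exact (hargmin β hβ).trans (sub_le_sub_left hweaken _)

theorem exists_run_decrease (hm : 0 < m) (hA : ∀ i j, |A i j| ≤ 1) (hν0 : 0 < ν)
    (hν1 : ν ≤ 1) (hℓ : LossClass ℓ) :
    ∃ c : ℝ, 0 < c ∧ ∀ rule : StepRule, rule.Admissible A ℓ →
      ∀ (x v : ℕ → Fin n → ℝ) (α : ℕ → ℝ), IsBoostRun A ℓ ν rule x v α → ∀ t,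
        risk ℓ (A *ᵥ x t) ≤ risk ℓ (A *ᵥ 0) ∧
        risk ℓ (A *ᵥ x (t + 1)) ≤
          risk ℓ (A *ᵥ x t) - c * (‖colGrad A ℓ (x t)‖ ^ 2 / risk ℓ (A *ᵥ x t)) := by
  set r := risk ℓ (A *ᵥ (0 : Fin n → ℝ))
  set C := levelConst m ℓ r
  have hC : 1 ≤ C := hℓ.one_le_levelConst m r
  refine ⟨ν / (8 * C ^ 6), by positivity, fun rule hrule x v α hrun => ?_⟩
  have hdecrease : ∀ t, risk ℓ (A *ᵥ x t) ≤ r → risk ℓ (A *ᵥ x (t + 1)) ≤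
      risk ℓ (A *ᵥ x t) - ν / (8 * C ^ 6) *
        (‖colGrad A ℓ (x t)‖ ^ 2 / risk ℓ (A *ᵥ x t)) := fun t ht => by
    have hstep := (hrun.stepSize t).risk_le hℓ hm hA hν0 hν1 hrule (hrun.direction t)
    rw [← hrun.update] at hstep
    refine hstep.trans (sub_le_sub_left ?_ _)
    have hrisk := hℓ.risk_pos hm (A *ᵥ x t)
    have hgrad := hℓ.l1norm_riskGrad_pos hm (A *ᵥ x t)
    have hconst : 0 < stepConst A ℓ (x t) := zero_lt_one.trans_le (hℓ.one_le_lossConst _)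
    calc ν / (8 * C ^ 6) * (‖colGrad A ℓ (x t)‖ ^ 2 / risk ℓ (A *ᵥ x t))
        = ν * ‖colGrad A ℓ (x t)‖ ^ 2 / (8 * (C ^ 4 * (C ^ 2 * risk ℓ (A *ᵥ x t)))) := by
          field_simp
      _ ≤ _ := by
          gcongr
          · exact hℓ.levelConst_mono hm hrisk ht
          · exact hℓ.l1norm_le_mul_risk hm ht
  have hlevel : ∀ t, risk ℓ (A *ᵥ x t) ≤ r := fun t => by
    induction t with
    | zero => rw [hrun.init]
    | succ t ih =>
      have := hℓ.risk_pos hm (A *ᵥ x t)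
      exact (hdecrease t ih).trans ((sub_le_self _ (by positivity)).trans ih)
  exact fun t => ⟨hlevel t, hdecrease t (hlevel t)⟩

end StepSize

section HardCore

theorem abs_dotProduct_le {k : ℕ} (u w : Fin k → ℝ) : |u ⬝ᵥ w| ≤ ‖u‖ * l1norm w := by
  rw [l1norm, Finset.mul_sum]
  refine (Finset.abs_sum_le_sum_abs _ _).trans (Finset.sum_le_sum fun i _ => ?_)
  rw [abs_mul]
  exact mul_le_mul_of_nonneg_right (norm_le_pi_norm u i) (abs_nonneg _)

theorem l1norm_nonneg {k : ℕ} (w : Fin k → ℝ) : 0 ≤ l1norm w :=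
  Finset.sum_nonneg fun _ _ => abs_nonneg _

theorem l1norm_le_mul_norm {k : ℕ} (w : Fin k → ℝ) : l1norm w ≤ k * ‖w‖ := by
  simpa [l1norm] using Finset.sum_le_card_nsmul Finset.univ _ _ fun i _ => norm_le_pi_norm w i

theorem l1norm_sub_smul_le {k : ℕ} (w u : Fin k → ℝ) (s : ℝ) :
    l1norm (w - s • u) ≤ l1norm w + |s| * l1norm u := by
  simp only [l1norm, Finset.mul_sum, ← abs_mul, ← Finset.sum_add_distrib]
  exact Finset.sum_le_sum fun i _ => abs_sub (w i) (s * u i)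

theorem abs_mulVec_le_l1norm {m n : ℕ} {A : Matrix (Fin m) (Fin n) ℝ} (hA : ∀ i j, |A i j| ≤ 1)
    (w : Fin n → ℝ) (i : Fin m) : |(A *ᵥ w) i| ≤ l1norm w :=
  (abs_dotProduct_le (A i) w).trans <| mul_le_of_le_one_left (l1norm_nonneg w) <|
    (pi_norm_le_iff_of_nonneg zero_le_one).2 (hA i)

theorem exists_mulVec_eq_l1norm_le {ι : Type*} [Fintype ι] {n : ℕ} (B : Matrix ι (Fin n) ℝ) :
    ∃ κ : ℝ, 0 ≤ κ ∧ ∀ x, ∃ y, B *ᵥ y = B *ᵥ x ∧ l1norm y ≤ κ * ‖B *ᵥ x‖ := by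
  obtain ⟨κ, hκ, hpreimage⟩ :=
    (LinearMap.toContinuousLinearMap B.mulVecLin.rangeRestrict).exists_preimage_norm_le
      B.mulVecLin.surjective_rangeRestrict
  refine ⟨n * κ, by positivity, fun x => ?_⟩
  obtain ⟨y, hy, hyx⟩ := hpreimage (B.mulVecLin.rangeRestrict x)
  refine ⟨y, congrArg Subtype.val hy, (l1norm_le_mul_norm y).trans ?_⟩
  rw [mul_assoc]
  exact mul_le_mul_of_nonneg_left hyx n.cast_nonneg

theorem exists_norm_le_mul_norm_posPart {ι : Type*} [Fintype ι] (V : Submodule ℝ (ι → ℝ))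
    (hV : ∀ w ∈ V, w ≤ 0 → w = 0) : ∃ κ : ℝ, 0 ≤ κ ∧ ∀ w ∈ V, ‖w‖ ≤ κ * ‖w⁺‖ := by
  have hcont : Continuous fun w : ι → ℝ => w⁺ :=
    continuous_pi fun i => (continuous_apply i).sup continuous_const
  have hcompact : IsCompact (Metric.sphere (0 : ι → ℝ) 1 ∩ V) :=
    (isCompact_sphere 0 1).inter_right V.closed_of_finiteDimensional
  obtain ⟨c, hc, hbound⟩ := hcompact.exists_forall_le' (f := fun w => ‖w⁺‖) (a := 0)
    hcont.norm.continuousOn fun w ⟨hw, hwV⟩ => by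
      refine norm_pos_iff.2 fun hzero => ?_
      simp [hV w hwV (posPart_eq_zero.1 hzero)] at hw
  refine ⟨c⁻¹, by positivity, fun w hw => ?_⟩
  rcases eq_or_ne w 0 with rfl | hw0
  · simp
  have hnorm : 0 < ‖w‖ := norm_pos_iff.2 hw0
  have hunit := hbound (‖w‖⁻¹ • w) ⟨by simp [norm_smul, hnorm.ne'], V.smul_mem _ hw⟩
  have hposPart : (‖w‖⁻¹ • w)⁺ = ‖w‖⁻¹ • w⁺ := by
    ext i
    simp [Pi.posPart_apply, posPart_def, mul_max_of_nonneg]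
  rw [hposPart, norm_smul, norm_inv, norm_norm, inv_mul_eq_div, le_div_iff₀ hnorm] at hunit
  rwa [inv_mul_eq_div, le_div_iff₀' hc]

theorem exists_add_mul_nonpos {ι : Type*} [Finite ι] {a u : ι → ℝ}
    (h : ∀ i, u i < 0 ∨ u i = 0 ∧ a i ≤ 0) : ∃ s : ℝ, ∀ i, a i + s * u i ≤ 0 := by
  refine (Filter.eventually_all.2 fun i => ?_).exists (f := Filter.atTop)
  rcases h i with hu | ⟨hu, ha⟩
  · exact (Filter.tendsto_atBot_add_const_left _ (a i)
      (Filter.tendsto_id.atTop_mul_const_of_neg hu)).eventually_le_atBot 0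
  · exact Filter.Eventually.of_forall fun s => by rwa [hu, mul_zero, add_zero]

theorem exists_mulVec_nonpos_maximal {ι κ : Type*} [Finite ι] [Fintype κ] (A : Matrix ι κ ℝ) :
    ∃ u, A *ᵥ u ≤ 0 ∧ ∀ x, A *ᵥ x ≤ 0 → ∀ i, (A *ᵥ x) i < 0 → (A *ᵥ u) i < 0 := by
  cases nonempty_fintype ι
  have hrow : ∀ i, ∃ w, A *ᵥ w ≤ 0 ∧ ∀ x, A *ᵥ x ≤ 0 → (A *ᵥ x) i < 0 → (A *ᵥ w) i < 0 := by
    intro i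
    by_cases h : ∃ w, A *ᵥ w ≤ 0 ∧ (A *ᵥ w) i < 0
    · obtain ⟨w, hw, hwi⟩ := h
      exact ⟨w, hw, fun _ _ _ => hwi⟩
    · exact ⟨0, by simp, fun x hx hxi => absurd ⟨x, hx, hxi⟩ h⟩
  choose w hw hstrict using hrow
  have hsum : ∀ k, (A *ᵥ ∑ i, w i) k = ∑ i, (A *ᵥ w i) k := fun k => by
    rw [Matrix.mulVec_sum, Finset.sum_apply]
  refine ⟨∑ i, w i, fun k => ?_, fun x hx i hxi => ?_⟩
  · rw [hsum]
    exact Finset.sum_nonpos fun i _ => hw i k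
  · rw [hsum]
    exact Finset.sum_neg' (fun k _ => hw k i) ⟨i, Finset.mem_univ i, hstrict i x hx hxi⟩

variable {m n : ℕ} {ℓ : ℝ → ℝ} {A : Matrix (Fin m) (Fin n) ℝ} {H : Finset (Fin m)}

/-- The hard core consists of the rows on which a weighting correct everywhere is never strictly
correct. -/
theorem exists_isHardCore (A : Matrix (Fin m) (Fin n) ℝ) : ∃ H, IsHardCore A H := by
  obtain ⟨u, hu, hmax⟩ := exists_mulVec_nonpos_maximal A
  refine ⟨Finset.univ.filter fun i => (A *ᵥ u) i = 0,
    ⟨u, fun i hi => (hu i).lt_of_ne (by simpa using hi), fun i hi => by simpa using hi⟩, ?_⟩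
  rintro x ⟨i, hi, hxi⟩
  by_contra! hx
  simp only [Finset.mem_filter_univ] at hi hx
  obtain ⟨s, hs⟩ := exists_add_mul_nonpos (a := A *ᵥ x) (u := A *ᵥ u) fun k =>
    (hu k).lt_or_eq.imp_right fun hk => ⟨hk, hx k hk⟩
  have hval : A *ᵥ (x + s • u) = A *ᵥ x + s • (A *ᵥ u) := by
    rw [Matrix.mulVec_add, Matrix.mulVec_smul]
  refine (hmax (x + s • u) (hval ▸ hs) i ?_).ne hi
  simpa [hval, hi] using hxi

theorem IsHardCore.exists_le_neg_one (hH : IsHardCore A H) :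
    ∃ u : Fin n → ℝ, (∀ i ∉ H, (A *ᵥ u) i ≤ -1) ∧ ∀ i ∈ H, (A *ᵥ u) i = 0 := by
  obtain ⟨⟨u, hneg, hzero⟩, -⟩ := hH
  obtain ⟨s, hs⟩ := exists_add_mul_nonpos (a := fun _ : {i // i ∉ H} => 1)
    (u := fun i => (A *ᵥ u) i) fun i => Or.inl (hneg i i.2)
  refine ⟨s • u, fun i hi => ?_, fun i hi => ?_⟩
  · rw [Matrix.mulVec_smul, Pi.smul_apply, smul_eq_mul]
    linarith [hs ⟨i, hi⟩]
  · rw [Matrix.mulVec_smul, Pi.smul_apply, hzero i hi, smul_zero]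

/-- The submatrix of `A` formed by the rows in `H`. -/
abbrev rowsOn (A : Matrix (Fin m) (Fin n) ℝ) (H : Finset (Fin m)) : Matrix H (Fin n) ℝ :=
  A.submatrix Subtype.val id

theorem IsHardCore.exists_norm_rowsOn_mulVec_le (hH : IsHardCore A H) :
    ∃ κ : ℝ, 0 ≤ κ ∧ ∀ x, ‖rowsOn A H *ᵥ x‖ ≤ κ * ‖(rowsOn A H *ᵥ x)⁺‖ := by
  obtain ⟨κ, hκ, hbound⟩ := exists_norm_le_mul_norm_posPart
    (LinearMap.range (rowsOn A H).mulVecLin) (by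
      rintro _ ⟨x, rfl⟩ hx
      refine le_antisymm hx fun i => not_lt.1 fun hneg => ?_
      obtain ⟨k, hk, hpos⟩ := hH.2 x ⟨i, i.2, hneg⟩
      exact (hx ⟨k, hk⟩).not_gt hpos)
  exact ⟨κ, hκ, fun x => hbound _ ⟨x, rfl⟩⟩

theorem IsHardCore.exists_norm_le_of_risk_le (hH : IsHardCore A H) (hm : 0 < m)
    (hℓ : LossClass ℓ) (r : ℝ) :
    ∃ R : ℝ, 0 ≤ R ∧ ∀ x, risk ℓ (A *ᵥ x) ≤ r → ‖rowsOn A H *ᵥ x‖ ≤ R := by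
  obtain ⟨κ, hκ, hbound⟩ := hH.exists_norm_rowsOn_mulVec_le
  refine ⟨κ * |Function.invFun ℓ (m * r)|, by positivity, fun x hx => (hbound x).trans ?_⟩
  gcongr
  refine (pi_norm_le_iff_of_nonneg (abs_nonneg _)).2 fun i => ?_
  rw [Pi.posPart_apply, Real.norm_of_nonneg (posPart_nonneg _)]
  exact max_le ((hℓ.le_invFun_of_risk_le hm hx i).trans (le_abs_self _)) (abs_nonneg _)

theorem isHardCore_empty_of_bestMargin_pos (h : 0 < bestMargin A) : IsHardCore A ∅ := by
  obtain ⟨x, hx, hpos⟩ : ∃ x : Fin n → ℝ, l1norm x = 1 ∧ 0 < margin A x := by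
    by_contra! hnonpos
    refine h.not_ge (Real.sSup_nonpos ?_)
    rintro _ ⟨x, hx, rfl⟩
    exact hnonpos x hx
  refine ⟨⟨x, fun i _ => ?_, by simp⟩, by simp⟩
  have hrow : margin A x ≤ -(A *ᵥ x) i / l1norm x := ciInf_le (Set.finite_range _).bddBelow i
  rw [hx, div_one] at hrow
  linarith

theorem IsHardCore.eq_univ_of_isMinOn (hH : IsHardCore A H) (hm : 0 < m) (hℓ : StrictMono ℓ)
    {y : Fin n → ℝ} (hy : ∀ z, risk ℓ (A *ᵥ y) ≤ risk ℓ (A *ᵥ z)) : H = Finset.univ := by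
  obtain ⟨⟨u, hneg, hzero⟩, -⟩ := hH
  refine Finset.eq_univ_iff_forall.2 fun i => by_contra fun hi => ?_
  refine (hy (y + u)).not_gt (mul_lt_mul_of_pos_left ?_ (by positivity))
  have hu : ∀ k, (A *ᵥ u) k ≤ 0 := fun k => by
    by_cases hk : k ∈ H
    · exact (hzero k hk).le
    · exact (hneg k hk).le
  rw [Matrix.mulVec_add]
  exact Finset.sum_lt_sum (fun k _ => hℓ.monotone (add_le_of_nonpos_right (hu k)))
    ⟨i, Finset.mem_univ i, hℓ (add_lt_of_neg_right _ (hneg i hi))⟩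

end HardCore

section GradientDomination

variable {m n : ℕ} {ℓ : ℝ → ℝ} {A : Matrix (Fin m) (Fin n) ℝ} {H : Finset (Fin m)}
  {x : Fin n → ℝ}

/-- The suboptimality of the weighting `x`. -/
noncomputable def excessRisk (A : Matrix (Fin m) (Fin n) ℝ) (ℓ : ℝ → ℝ) (x : Fin n → ℝ) : ℝ :=
  risk ℓ (A *ᵥ x) - optRisk A ℓ

namespace LossClass

theorem excessRisk_nonneg (hℓ : LossClass ℓ) (hm : 0 < m) (A : Matrix (Fin m) (Fin n) ℝ)
    (x : Fin n → ℝ) : 0 ≤ excessRisk A ℓ x :=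
  sub_nonneg.2 (ciInf_le ⟨0, Set.forall_mem_range.2 fun _ => (hℓ.risk_pos hm _).le⟩ x)

theorem excessRisk_le_risk (hℓ : LossClass ℓ) (hm : 0 < m) (A : Matrix (Fin m) (Fin n) ℝ)
    (x : Fin n → ℝ) : excessRisk A ℓ x ≤ risk ℓ (A *ᵥ x) :=
  sub_le_self _ (Real.iInf_nonneg fun _ => (hℓ.risk_pos hm _).le)

end LossClass

theorem excessRisk_le {r B : ℝ} (hB : 0 ≤ B) (hx : risk ℓ (A *ᵥ x) ≤ r)
    (h : ∀ y, risk ℓ (A *ᵥ y) ≤ r → risk ℓ (A *ᵥ x) - risk ℓ (A *ᵥ y) ≤ B) :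
    excessRisk A ℓ x ≤ B := by
  refine sub_le_comm.1 (le_ciInf fun y => ?_)
  rcases le_total (risk ℓ (A *ᵥ y)) r with hy | hy
  · exact sub_le_comm.1 (h y hy)
  · linarith

theorem riskGrad_dotProduct_mulVec_le (ℓ : ℝ → ℝ) (A : Matrix (Fin m) (Fin n) ℝ)
    (x w : Fin n → ℝ) :
    riskGrad ℓ (A *ᵥ x) ⬝ᵥ (A *ᵥ w) ≤ ‖colGrad A ℓ x‖ * l1norm w := by
  rw [Matrix.dotProduct_mulVec, ← Matrix.mulVec_transpose]
  exact (le_abs_self _).trans (abs_dotProduct_le _ _)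

theorem LossClass.risk_sub_le_riskGrad_dotProduct (hℓ : LossClass ℓ) (hm : 0 < m)
    {z w q : Fin m → ℝ} {r : ℝ} (hz : risk ℓ z ≤ r) (hqH : ∀ i ∈ H, q i = z i - w i)
    (hq : ∀ i ∉ H, levelConst m ℓ r ^ 2 ≤ q i) :
    risk ℓ z - (m : ℝ)⁻¹ * ∑ i ∈ H, ℓ (w i) ≤ riskGrad ℓ z ⬝ᵥ q := by
  rw [riskGrad_dotProduct hℓ.differentiable, risk, ← mul_sub, ← Finset.sum_ite_mem_eq H,
    ← Finset.sum_sub_distrib]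
  refine mul_le_mul_of_nonneg_left (Finset.sum_le_sum fun i _ => ?_) (by positivity)
  have hderiv := hℓ.deriv_pos (z i)
  split_ifs with hi
  · rw [hqH i hi]
    linarith [hℓ.add_deriv_mul_sub_le (z i) (w i)]
  · calc ℓ (z i) - 0 ≤ levelConst m ℓ r ^ 2 * deriv ℓ (z i) := by
          rw [sub_zero]
          exact hℓ.le_mul_deriv (hℓ.le_invFun_of_risk_le hm hz i)
      _ ≤ deriv ℓ (z i) * q i := by
          rw [mul_comm]
          exact mul_le_mul_of_nonneg_left (hq i hi) hderiv.le

/-- The direction from `x` to a competitor `y` on the rows in `H` is corrected on the other rows by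
a multiple of a weighting that vanishes on `H` and is strictly correct elsewhere. -/
theorem IsHardCore.exists_risk_sub_le_mul_norm_colGrad (hH : IsHardCore A H) (hm : 0 < m)
    (hA : ∀ i j, |A i j| ≤ 1) (hℓ : LossClass ℓ) (r : ℝ) :
    ∃ W : ℝ, 0 < W ∧ ∀ x y, risk ℓ (A *ᵥ x) ≤ r → risk ℓ (A *ᵥ y) ≤ r →
      risk ℓ (A *ᵥ x) - (m : ℝ)⁻¹ * ∑ i ∈ H, ℓ ((A *ᵥ y) i) ≤ W * ‖colGrad A ℓ x‖ := by
  obtain ⟨u, hu, hu0⟩ := hH.exists_le_neg_one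
  obtain ⟨R, hR, hbound⟩ := hH.exists_norm_le_of_risk_le hm hℓ r
  obtain ⟨κ, hκ, hpreimage⟩ := exists_mulVec_eq_l1norm_le (rowsOn A H)
  have hu_nonneg := l1norm_nonneg u
  set s : ℝ := levelConst m ℓ r ^ 2 + κ * (R + R)
  have hs : 0 ≤ s := by positivity
  refine ⟨κ * (R + R) + s * l1norm u + 1, by positivity, fun x y hx hy => ?_⟩
  obtain ⟨w, hw, hw_l1⟩ := hpreimage (x - y)
  replace hw_l1 : l1norm w ≤ κ * (R + R) := hw_l1.trans <| by
    rw [Matrix.mulVec_sub]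
    gcongr
    exact (norm_sub_le _ _).trans (add_le_add (hbound x hx) (hbound y hy))
  have hdir : ∀ i, (A *ᵥ (w - s • u)) i = (A *ᵥ w) i - s * (A *ᵥ u) i := fun i => by
    rw [Matrix.mulVec_sub, Matrix.mulVec_smul]
    rfl
  calc _ ≤ riskGrad ℓ (A *ᵥ x) ⬝ᵥ (A *ᵥ (w - s • u)) := by
        refine hℓ.risk_sub_le_riskGrad_dotProduct hm hx (fun i hi => ?_) fun i hi => ?_
        · rw [hdir, hu0 i hi, mul_zero, sub_zero]
          exact (congrFun hw ⟨i, hi⟩).trans (congrFun (Matrix.mulVec_sub A x y) i)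
        · rw [hdir]
          linarith [(abs_le.1 (abs_mulVec_le_l1norm hA w i)).1,
            mul_le_mul_of_nonneg_left (hu i hi) hs]
    _ ≤ ‖colGrad A ℓ x‖ * l1norm (w - s • u) := riskGrad_dotProduct_mulVec_le ℓ A x _
    _ ≤ ‖colGrad A ℓ x‖ * (κ * (R + R) + s * l1norm u + 1) := by
        gcongr
        linarith [abs_of_nonneg hs ▸ l1norm_sub_smul_le w u s]
    _ = _ := mul_comm _ _

theorem sq_norm_le_sum_sq {ι : Type*} [Fintype ι] (q : ι → ℝ) : ‖q‖ ^ 2 ≤ ∑ i, q i ^ 2 := by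
  refine (Real.le_sqrt (norm_nonneg q) (Finset.sum_nonneg fun i _ => sq_nonneg _)).1 ?_
  exact (pi_norm_le_iff_of_nonneg (Real.sqrt_nonneg _)).2 fun i => Real.abs_le_sqrt <|
    Finset.single_le_sum (f := fun i => q i ^ 2) (fun i _ => sq_nonneg _) (Finset.mem_univ i)

theorem LossClass.exists_strongConvex (hℓ : LossClass ℓ) (R : ℝ) :
    ∃ μ : ℝ, 0 < μ ∧ ∀ a b, |a| ≤ R → |b| ≤ R →
      ℓ a + deriv ℓ a * (b - a) + μ * (b - a) ^ 2 ≤ ℓ b := by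
  obtain ⟨μ, hμ, hbound⟩ := isCompact_Icc.exists_forall_le' (s := Set.Icc (-R) R)
    hℓ.continuous_deriv_deriv.continuousOn fun a _ => hℓ.deriv_deriv_pos a
  exact ⟨μ / 2, half_pos hμ, fun a b ha hb => hℓ.add_deriv_mul_sub_add_sq_le (convex_Icc _ _)
    hbound (abs_le.1 ha) (abs_le.1 hb)⟩

theorem LossClass.exists_strongConvex_risk (hℓ : LossClass ℓ) (hm : 0 < m) (R : ℝ) :
    ∃ μ : ℝ, 0 < μ ∧ ∀ z w : Fin m → ℝ, ‖z‖ ≤ R → ‖w‖ ≤ R →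
      risk ℓ z + riskGrad ℓ z ⬝ᵥ (w - z) + μ * ‖w - z‖ ^ 2 ≤ risk ℓ w := by
  obtain ⟨μ, hμ, hconvex⟩ := hℓ.exists_strongConvex R
  refine ⟨(m : ℝ)⁻¹ * μ, by positivity, fun z w hz hw => ?_⟩
  calc _ ≤ risk ℓ z + riskGrad ℓ z ⬝ᵥ (w - z) + (m : ℝ)⁻¹ * μ * ∑ i, (w - z) i ^ 2 := by
        gcongr
        exact sq_norm_le_sum_sq _
    _ = (m : ℝ)⁻¹ * ∑ i, (ℓ (z i) + deriv ℓ (z i) * (w i - z i) + μ * (w i - z i) ^ 2) := by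
        rw [riskGrad_dotProduct hℓ.differentiable, risk, mul_assoc, Finset.mul_sum _ _ μ]
        simp only [Finset.sum_add_distrib, mul_add, Pi.sub_apply]
    _ ≤ risk ℓ w := by
        refine mul_le_mul_of_nonneg_left (Finset.sum_le_sum fun i _ => ?_) (by positivity)
        exact hconvex _ _ ((norm_le_pi_norm z i).trans hz) ((norm_le_pi_norm w i).trans hw)

theorem IsHardCore.exists_excessRisk_le_mul_sq_norm_colGrad
    (hH : IsHardCore A Finset.univ) (hm : 0 < m) (hℓ : LossClass ℓ) (r : ℝ) :
    ∃ W : ℝ, 0 < W ∧ ∀ x, risk ℓ (A *ᵥ x) ≤ r →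
      excessRisk A ℓ x ≤ W * ‖colGrad A ℓ x‖ ^ 2 := by
  obtain ⟨R, hR, hbound⟩ := hH.exists_norm_le_of_risk_le hm hℓ r
  replace hbound : ∀ x, risk ℓ (A *ᵥ x) ≤ r → ‖A *ᵥ x‖ ≤ R := fun x hx =>
    (pi_norm_le_iff_of_nonneg hR).2 fun i =>
      (norm_le_pi_norm (rowsOn A Finset.univ *ᵥ x) ⟨i, Finset.mem_univ i⟩).trans (hbound x hx)
  obtain ⟨κ, -, hpreimage⟩ := exists_mulVec_eq_l1norm_le A
  obtain ⟨μ, hμ, hconvex⟩ := hℓ.exists_strongConvex_risk hm R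
  refine ⟨κ ^ 2 / (4 * μ) + 1, by positivity, fun x hx => ?_⟩
  refine excessRisk_le (by positivity) hx fun y hy => ?_
  obtain ⟨w, hw, hw_l1⟩ := hpreimage (x - y)
  rw [Matrix.mulVec_sub] at hw hw_l1
  have hxy := hconvex _ _ (hbound x hx) (hbound y hy)
  rw [← neg_sub (A *ᵥ x), dotProduct_neg, norm_neg] at hxy
  set G := ‖colGrad A ℓ x‖
  set d := ‖A *ᵥ x - A *ᵥ y‖
  have hslope : riskGrad ℓ (A *ᵥ x) ⬝ᵥ (A *ᵥ x - A *ᵥ y) ≤ G * (κ * d) := by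
    rw [← hw]
    exact (riskGrad_dotProduct_mulVec_le ℓ A x w).trans
      (mul_le_mul_of_nonneg_left hw_l1 (norm_nonneg _))
  have hsquare : G * (κ * d) - μ * d ^ 2 ≤ κ ^ 2 / (4 * μ) * G ^ 2 := by
    have hgap : κ ^ 2 / (4 * μ) * G ^ 2 - (G * (κ * d) - μ * d ^ 2) =
        (κ * G - 2 * μ * d) ^ 2 / (4 * μ) := by
      field_simp
      ring
    exact sub_nonneg.1 (hgap ▸ by positivity)
  linarith [sq_nonneg G]

/-- A Łojasiewicz inequality on the sublevel sets of the risk. Its exponent `p` governs the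
convergence rate: `p = 1` gives a linear rate, `p = 2` the rate `1 / t`. -/
def GradientDominated (A : Matrix (Fin m) (Fin n) ℝ) (ℓ : ℝ → ℝ) (p : ℕ) : Prop :=
  ∀ r > 0, ∃ W > 0, ∀ x, risk ℓ (A *ᵥ x) ≤ r →
    excessRisk A ℓ x ^ p * risk ℓ (A *ᵥ x) ≤ W * ‖colGrad A ℓ x‖ ^ 2

theorem gradientDominated_two (hm : 0 < m) (hA : ∀ i j, |A i j| ≤ 1) (hℓ : LossClass ℓ) :
    GradientDominated A ℓ 2 := fun r hr => by
  obtain ⟨H, hH⟩ := exists_isHardCore A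
  obtain ⟨W, hW, hbound⟩ := hH.exists_risk_sub_le_mul_norm_colGrad hm hA hℓ r
  refine ⟨W ^ 2 * r, by positivity, fun x hx => ?_⟩
  have hexcess : excessRisk A ℓ x ≤ W * ‖colGrad A ℓ x‖ := by
    refine excessRisk_le (by positivity) hx fun y hy => le_trans ?_ (hbound x y hx hy)
    refine sub_le_sub_left (mul_le_mul_of_nonneg_left ?_ (by positivity)) _
    exact Finset.sum_le_univ_sum_of_nonneg fun i => hℓ.nonneg _
  have := hℓ.excessRisk_nonneg hm A x
  have := hℓ.risk_pos hm (A *ᵥ x)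
  calc _ ≤ (W * ‖colGrad A ℓ x‖) ^ 2 * r := by gcongr
    _ = _ := by ring

theorem IsHardCore.gradientDominated_one_of_empty (hH : IsHardCore A ∅) (hm : 0 < m)
    (hA : ∀ i j, |A i j| ≤ 1) (hℓ : LossClass ℓ) : GradientDominated A ℓ 1 := fun r _ => by
  obtain ⟨W, hW, hbound⟩ := hH.exists_risk_sub_le_mul_norm_colGrad hm hA hℓ r
  refine ⟨W ^ 2, by positivity, fun x hx => ?_⟩
  have hrisk : risk ℓ (A *ᵥ x) ≤ W * ‖colGrad A ℓ x‖ := by simpa using hbound x x hx hx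
  have := hℓ.risk_pos hm (A *ᵥ x)
  calc _ ≤ (W * ‖colGrad A ℓ x‖) ^ 1 * (W * ‖colGrad A ℓ x‖) := by
        gcongr
        · exact hℓ.excessRisk_nonneg hm A x
        · exact (hℓ.excessRisk_le_risk hm A x).trans hrisk
    _ = _ := by ring

theorem IsHardCore.gradientDominated_one_of_univ (hH : IsHardCore A Finset.univ) (hm : 0 < m)
    (hℓ : LossClass ℓ) : GradientDominated A ℓ 1 := fun r hr => by
  obtain ⟨W, hW, hbound⟩ := hH.exists_excessRisk_le_mul_sq_norm_colGrad hm hℓ r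
  refine ⟨W * r, by positivity, fun x hx => ?_⟩
  have := hℓ.risk_pos hm (A *ᵥ x)
  calc _ ≤ W * ‖colGrad A ℓ x‖ ^ 2 * r := by
        rw [pow_one]
        gcongr
        exact hbound x hx
    _ = _ := by ring

theorem GradientDominated.exists_excessRisk_succ_le {p : ℕ} (h : GradientDominated A ℓ p)
    (hm : 0 < m) (hA : ∀ i j, |A i j| ≤ 1) {ν : ℝ} (hν0 : 0 < ν) (hν1 : ν ≤ 1)
    (hℓ : LossClass ℓ) :
    ∃ c : ℝ, 0 < c ∧ ∀ rule : StepRule, rule.Admissible A ℓ →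
      ∀ (x v : ℕ → Fin n → ℝ) (α : ℕ → ℝ), IsBoostRun A ℓ ν rule x v α → ∀ t,
        excessRisk A ℓ (x (t + 1)) ≤ excessRisk A ℓ (x t) - c * excessRisk A ℓ (x t) ^ p := by
  obtain ⟨c, hc, hdecrease⟩ := exists_run_decrease (n := n) hm hA hν0 hν1 hℓ
  obtain ⟨W, hW, hbound⟩ := h _ (hℓ.risk_pos hm (A *ᵥ (0 : Fin n → ℝ)))
  refine ⟨c / W, by positivity, fun rule hrule x v α hrun t => ?_⟩
  obtain ⟨hlevel, hstep⟩ := hdecrease rule hrule x v α hrun t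
  have hdominated : c / W * excessRisk A ℓ (x t) ^ p ≤
      c * (‖colGrad A ℓ (x t)‖ ^ 2 / risk ℓ (A *ᵥ x t)) := by
    rw [div_mul_eq_mul_div, mul_div_assoc]
    gcongr c * ?_
    rw [div_le_div_iff₀ hW (hℓ.risk_pos hm _), mul_comm _ W]
    exact hbound _ hlevel
  unfold excessRisk at hdominated ⊢
  linarith

end GradientDomination

end Boosting

theorem mainTheorem7 {m n : ℕ} (hm : 0 < m) (hn : 0 < n)
    (A : Matrix (Fin m) (Fin n) ℝ) (hA : ∀ i j, |A i j| ≤ 1)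
    (ν : ℝ) (hν0 : 0 < ν) (hν1 : ν ≤ 1)
    (ℓ : ℝ → ℝ) (hℓ : Boosting.LossClass ℓ) :
    (∃ K : ℝ, 0 < K ∧
      ∀ (rule : Boosting.StepRule),
        (rule = Boosting.StepRule.adaBoost →
          ℓ = Real.exp ∧ ∀ i j, A i j = -1 ∨ A i j = 1) →
        ∀ (x v : ℕ → Fin n → ℝ) (α : ℕ → ℝ), Boosting.IsBoostRun A ℓ ν rule x v α →
          ∀ ε : ℝ, 0 < ε → ∀ t : ℕ, K * (1 / ε) ≤ t →
            Boosting.risk ℓ (A *ᵥ x t) - Boosting.optRisk A ℓ ≤ ε) ∧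
    ((0 < Boosting.bestMargin A ∨
        (∃ y : Fin n → ℝ, ∀ z : Fin n → ℝ,
          Boosting.risk ℓ (A *ᵥ y) ≤ Boosting.risk ℓ (A *ᵥ z)) ∨
        (∃ H : Finset (Fin m), Boosting.IsHardCore A H ∧ H.card = m)) →
      ∃ K : ℝ, 0 < K ∧
        ∀ (rule : Boosting.StepRule),
          (rule = Boosting.StepRule.adaBoost →
            ℓ = Real.exp ∧ ∀ i j, A i j = -1 ∨ A i j = 1) →
          ∀ (x v : ℕ → Fin n → ℝ) (α : ℕ → ℝ), Boosting.IsBoostRun A ℓ ν rule x v α →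
            ∀ ε : ℝ, 0 < ε → ∀ t : ℕ, K * max 1 (Real.log (1 / ε)) ≤ t →
              Boosting.risk ℓ (A *ᵥ x t) - Boosting.optRisk A ℓ ≤ ε) := by
  constructor
  · obtain ⟨c, hc, hstep⟩ :=
      (Boosting.gradientDominated_two hm hA hℓ).exists_excessRisk_succ_le hm hA hν0 hν1 hℓ
    exact ⟨1 / c, by positivity, fun rule hrule x v α hrun _ hε _ ht =>
      Boosting.le_of_succ_le_sub_sq (fun t => hℓ.excessRisk_nonneg hm A (x t)) hc
        (hstep rule hrule x v α hrun) hε ht⟩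
  · intro hcases
    have hdom : Boosting.GradientDominated A ℓ 1 := by
      rcases hcases with hmargin | ⟨y, hy⟩ | ⟨H, hH, hcard⟩
      · exact (Boosting.isHardCore_empty_of_bestMargin_pos hmargin).gradientDominated_one_of_empty
          hm hA hℓ
      · obtain ⟨H, hH⟩ := Boosting.exists_isHardCore A
        exact (hH.eq_univ_of_isMinOn hm hℓ.strictMono hy ▸ hH).gradientDominated_one_of_univ hm hℓ
      · obtain rfl := Finset.eq_univ_of_card H (by simpa using hcard)
        exact hH.gradientDominated_one_of_univ hm hℓ
    obtain ⟨c, hc, hstep⟩ := hdom.exists_excessRisk_succ_le hm hA hν0 hν1 hℓ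
    simp only [pow_one] at hstep
    exact ⟨(|Real.log (Boosting.risk ℓ (A *ᵥ 0))| + 1) / c, by positivity,
      fun rule hrule x v α hrun _ hε _ ht =>
        Boosting.le_of_succ_le_sub_mul (fun t => hℓ.excessRisk_nonneg hm A (x t)) hc
          (hstep rule hrule x v α hrun) (hℓ.risk_pos hm (A *ᵥ 0))
          (hrun.init ▸ hℓ.excessRisk_le_risk hm A (x 0)) hε ht⟩
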